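/- A real symmetric $n\times n$ matrix $M$ is called completely positive semidefinite (cpsd) if there are $d\geq 1$ and real symmetric positive semidefinite $d\times d$ matrices $A_1,\dots,A_n$ with $M_{ij}=\operatorname{tr}(A_iA_j)$ for all $i,j$ (a Gram representation of $M$); the smallest such $d\ge 1$ is the cpsd-rank of $M$. Let $n\geq 1$ and let $M$ be an $n\times n$ cpsd matrix that has a Gram representation consisting of orthogonal projections $P_1,\dots,P_n$ (real symmetric idempotent $d\times d$ matrices). Set $L=\max_i M_{ii}$ and $\ell=\max_i\operatorname{tr}(P_i)$. Then $\ell=L$, and for every $0<\varepsilon<\tfrac12L^2$ there exists an $n\times n$ cpsd matrix $N$ such that $$\text{cpsd-rank}(N)\leq\min\left\{n\left\lceil\frac{9L^3}{2\varepsilon^2}\right\rceil,\ \frac{(6L)^4\log\left(n\left\lceil\frac{18L^3}{\varepsilon^2}\right\rceil+1\right)}{\varepsilon^2}\right\}$$ and $|M_{ij}-N_{ij}|<\varepsilon$ for all $i,j\in\{1,\dots,n\}$. Here $\log$ is the natural logarithm. -/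

import Mathlib

/-- `A₁, …, Aₙ`, real symmetric positive semidefinite `d × d` matrices, form a Gram representation
of `M` with respect to the trace inner product `⟨A, B⟩ = tr (B A)`. -/
def IsPsdGramRep {n d : ℕ} (M : Matrix (Fin n) (Fin n) ℝ)
    (A : Fin n → Matrix (Fin d) (Fin d) ℝ) : Prop :=
  (∀ i, (A i).PosSemidef) ∧ ∀ i j, M i j = (A j * A i).trace

/-- `M` is completely positive semidefinite. -/
def IsCpsd {n : ℕ} (M : Matrix (Fin n) (Fin n) ℝ) : Prop :=
  ∃ d : ℕ, 1 ≤ d ∧ ∃ A : Fin n → Matrix (Fin d) (Fin d) ℝ, IsPsdGramRep M A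

/-- The cpsd-rank: the smallest `d ≥ 1` such that `M` has a Gram representation by real psd
`d × d` matrices. It is meaningful for `M` with `IsCpsd M`, where the set is nonempty. -/
noncomputable def cpsdRank {n : ℕ} (M : Matrix (Fin n) (Fin n) ℝ) : ℕ :=
  sInf {d : ℕ | 1 ≤ d ∧ ∃ A : Fin n → Matrix (Fin d) (Fin d) ℝ, IsPsdGramRep M A}

/-! Since `P i` is idempotent, `M i i` is its trace, so the two maxima agree. A projection is a sum
of rank-one projections onto orthonormal vectors, so `M i j` is a sum of at most `L ^ 2` squared
inner products of unit vectors, of which there are at most `n * L`. Johnson-Lindenstrauss moves them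
to dimension about `log (n * L) / δ ^ 2`, changing inner products by at most `δ`. The squared inner
products of the images again give a cpsd matrix; `δ = ε / (3 * L ^ 2)` makes the error less than
`ε`. The linear bound in the minimum needs no approximation: for `ε ≤ L` it is at least `n * L`,
which bounds the dimension of the span of the vectors, so `N = M` works. For `ε > L`, `N = 0` works.
-/

section CpsdApproximation

open MeasureTheory ProbabilityTheory Module

/-! ### Exponential moments of squared Gaussians -/

/-- The moment generating function of the centered square of a standard Gaussian variable. -/
lemma integral_exp_mul_sq_sub_one_gaussianReal {t : ℝ} (ht : t < 1 / 2) :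
    Integrable (fun z : ℝ => Real.exp (t * (z ^ 2 - 1))) (gaussianReal 0 1) ∧
    ∫ z, Real.exp (t * (z ^ 2 - 1)) ∂(gaussianReal 0 1) =
      Real.exp (-t) * (√(1 - 2 * t))⁻¹ := by
  have key : ∀ z : ℝ, gaussianPDFReal 0 1 z * Real.exp (t * (z ^ 2 - 1)) =
      Real.exp (-t) * (√(2 * Real.pi))⁻¹ * Real.exp (-((1 - 2 * t) / 2) * z ^ 2) := by
    intro z
    have h : Real.exp (-z ^ 2 / 2) * Real.exp (t * (z ^ 2 - 1)) =
        Real.exp (-t) * Real.exp (-((1 - 2 * t) / 2) * z ^ 2) := by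
      rw [← Real.exp_add, ← Real.exp_add]; congr 1; ring
    simp only [gaussianPDFReal, NNReal.coe_one, mul_one, sub_zero]
    linear_combination (√(2 * Real.pi))⁻¹ * h
  have hb : 0 < (1 - 2 * t) / 2 := by linarith
  constructor
  · rw [gaussianReal_of_var_ne_zero _ one_ne_zero,
      integrable_withDensity_iff_integrable_smul' (measurable_gaussianPDF _ _)
        (Filter.Eventually.of_forall fun _ => gaussianPDF_lt_top)]
    simp only [toReal_gaussianPDF, smul_eq_mul, key]
    exact (integrable_exp_neg_mul_sq hb).const_mul _
  · rw [integral_gaussianReal_eq_integral_smul one_ne_zero]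
    simp only [smul_eq_mul, key]
    rw [integral_const_mul, integral_gaussian, mul_assoc]
    congr 1
    have h1 : Real.pi / ((1 - 2 * t) / 2) = 2 * Real.pi * (1 - 2 * t)⁻¹ := by
      field_simp
    rw [h1, Real.sqrt_mul (x := 2 * Real.pi) (by positivity), Real.sqrt_inv, ← mul_assoc,
      inv_mul_cancel₀ (by positivity), one_mul]

/-- The centered square of a standard Gaussian variable is sub-exponential. -/
lemma integral_exp_mul_sq_sub_one_gaussianReal_le {t : ℝ} (ht : |t| ≤ 1 / 6) :
    ∫ z, Real.exp (t * (z ^ 2 - 1)) ∂(gaussianReal 0 1) ≤ Real.exp (2 * t ^ 2) := by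
  obtain ⟨h1, h2⟩ := abs_le.1 ht
  rw [(integral_exp_mul_sq_sub_one_gaussianReal (by linarith)).2]
  have hpos : 0 < 1 - 2 * t := by linarith
  rw [← div_eq_mul_inv, div_le_iff₀ (Real.sqrt_pos.2 hpos)]
  -- For `t ≥ 0`, `(1 - 2t)(1 + 2t + 6t²) = 1 + 2t²(1 - 6t)`, which is where `1 / 6` comes from; for
  -- `t ≤ 0`, `(1 - 2t)(1 + 2t + 4t²) = 1 - 8t³`.
  have hsq : Real.exp (-t - 2 * t ^ 2) ^ 2 ≤ 1 - 2 * t := by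
    rw [← Real.exp_nat_mul]
    have e : ((2 : ℕ) : ℝ) * (-t - 2 * t ^ 2) = -(2 * t + 4 * t ^ 2) := by push_cast; ring
    rw [e, Real.exp_neg, inv_le_iff_one_le_mul₀ (Real.exp_pos _)]
    rcases le_total 0 t with h | h
    · have hq := Real.quadratic_le_exp_of_nonneg (x := 2 * t + 4 * t ^ 2) (by positivity)
      have hq' : 1 + 2 * t + 6 * t ^ 2 ≤ Real.exp (2 * t + 4 * t ^ 2) := by
        nlinarith [pow_nonneg h 3, pow_nonneg h 4]
      nlinarith [mul_le_mul_of_nonneg_left hq' hpos.le, mul_nonneg (sq_nonneg t) h,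
        mul_nonneg (sq_nonneg t) (sub_nonneg.2 h2)]
    · have hq := Real.add_one_le_exp (2 * t + 4 * t ^ 2)
      nlinarith [mul_le_mul_of_nonneg_left hq hpos.le, mul_nonneg (sq_nonneg t) (neg_nonneg.2 h)]
  have := Real.le_sqrt_of_sq_le hsq
  calc Real.exp (-t) = Real.exp (2 * t ^ 2) * Real.exp (-t - 2 * t ^ 2) := by
        rw [← Real.exp_add]; congr 1; ring
    _ ≤ _ := by gcongr

variable {E : Type*} [NormedAddCommGroup E] [InnerProductSpace ℝ E] [FiniteDimensional ℝ E]

lemma stdGaussian_map_inner [MeasurableSpace E] [BorelSpace E] {x : E} (hx : ‖x‖ = 1) :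
    (stdGaussian E).map (fun g => inner ℝ x g) = gaussianReal 0 1 := by
  have h := IsGaussian.map_eq_gaussianReal (μ := stdGaussian E) (innerSL ℝ x)
  rw [integral_strongDual_stdGaussian, variance_dual_stdGaussian, innerSL_apply_norm, hx] at h
  simpa using h

/-- Some vector does at most as badly as a standard Gaussian one against finitely many weighted
exponential deviations. -/
lemma exists_sum_exp_inner_sq_le (T : Finset E) (hT : ∀ x ∈ T, ‖x‖ = 1) {t : ℝ}
    (ht : |t| ≤ 1 / 6) (a b : E → ℝ) (ha : ∀ x, 0 ≤ a x) (hb : ∀ x, 0 ≤ b x) :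
    ∃ g : E, ∑ x ∈ T, (a x * Real.exp (t * (inner ℝ x g ^ 2 - 1)) +
        b x * Real.exp (-t * (inner ℝ x g ^ 2 - 1))) ≤
      Real.exp (2 * t ^ 2) * ∑ x ∈ T, (a x + b x) := by
  let _ : MeasurableSpace E := borel E
  have : BorelSpace E := ⟨rfl⟩
  have main : ∀ s : ℝ, |s| ≤ 1 / 6 → ∀ x ∈ T,
      Integrable (fun g => Real.exp (s * (inner ℝ x g ^ 2 - 1))) (stdGaussian E) ∧
      ∫ g, Real.exp (s * (inner ℝ x g ^ 2 - 1)) ∂(stdGaussian E) ≤ Real.exp (2 * s ^ 2) := by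
    intro s hs x hx
    have hm : AEMeasurable (fun g => inner ℝ x g) (stdGaussian E) := by fun_prop
    have hf : AEStronglyMeasurable (fun z : ℝ => Real.exp (s * (z ^ 2 - 1)))
        ((stdGaussian E).map (fun g => inner ℝ x g)) := by fun_prop
    have hlt : s < 1 / 2 := by linarith [(abs_le.1 hs).2]
    constructor
    · have := (integral_exp_mul_sq_sub_one_gaussianReal hlt).1
      rw [← stdGaussian_map_inner (hT x hx)] at this
      exact this.comp_aemeasurable hm
    · have := integral_exp_mul_sq_sub_one_gaussianReal_le hs
      rwa [← stdGaussian_map_inner (hT x hx), integral_map hm hf] at this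
  have ht' : |-t| ≤ 1 / 6 := by rwa [abs_neg]
  have hi : ∀ x ∈ T, Integrable (fun g => a x * Real.exp (t * (inner ℝ x g ^ 2 - 1)) +
      b x * Real.exp (-t * (inner ℝ x g ^ 2 - 1))) (stdGaussian E) := fun x hx =>
    ((main t ht x hx).1.const_mul _).add ((main (-t) ht' x hx).1.const_mul _)
  obtain ⟨g, hg⟩ := exists_le_integral (integrable_finsetSum T hi)
  refine ⟨g, hg.trans ?_⟩
  rw [integral_finsetSum T hi, Finset.mul_sum]
  refine Finset.sum_le_sum fun x hx => ?_
  rw [integral_add ((main t ht x hx).1.const_mul _) ((main (-t) ht' x hx).1.const_mul _),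
    integral_const_mul, integral_const_mul]
  have h1 := mul_le_mul_of_nonneg_left (main t ht x hx).2 (ha x)
  have h2 := mul_le_mul_of_nonneg_left (main (-t) ht' x hx).2 (hb x)
  rw [neg_sq] at h2
  linarith

/-- Method of conditional expectations: vectors are chosen one at a time, the exponentials
accumulated so far serving as weights, so no product measure is needed. -/
lemma exists_sum_exp_sum_inner_sq_le (T : Finset E) (hT : ∀ x ∈ T, ‖x‖ = 1) {t : ℝ}
    (ht : |t| ≤ 1 / 6) (k : ℕ) :
    ∃ g : Fin k → E, ∑ x ∈ T, (Real.exp (t * ((∑ j, inner ℝ x (g j) ^ 2) - k)) +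
        Real.exp (-t * ((∑ j, inner ℝ x (g j) ^ 2) - k))) ≤
      2 * T.card * Real.exp (2 * t ^ 2 * k) := by
  induction k with
  | zero => exact ⟨Fin.elim0, by simp [two_mul]⟩
  | succ k ih =>
    obtain ⟨g, hg⟩ := ih
    obtain ⟨v, hv⟩ := exists_sum_exp_inner_sq_le T hT ht
      (fun x => Real.exp (t * ((∑ j, inner ℝ x (g j) ^ 2) - k)))
      (fun x => Real.exp (-t * ((∑ j, inner ℝ x (g j) ^ 2) - k)))
      (fun _ => (Real.exp_pos _).le) (fun _ => (Real.exp_pos _).le)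
    refine ⟨Fin.cons v g, ?_⟩
    calc _ = _ := Finset.sum_congr rfl fun x _ => ?_
      _ ≤ _ := hv
      _ ≤ _ := mul_le_mul_of_nonneg_left hg (Real.exp_pos _).le
      _ = _ := ?_
    · rw [← Real.exp_add, ← Real.exp_add, Fin.sum_univ_succ]
      simp only [Fin.cons_zero, Fin.cons_succ, Nat.cast_succ]
      congr 2 <;> ring
    · rw [mul_left_comm, ← Real.exp_add]
      push_cast
      congr 2; ring

/-! ### Johnson-Lindenstrauss dimension reduction -/

/-- The **Johnson-Lindenstrauss lemma** for squared norms of finitely many unit vectors. -/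
lemma exists_linearMap_abs_norm_sq_sub_one_le (T : Finset E) (hT : ∀ x ∈ T, ‖x‖ = 1) {δ : ℝ}
    (hδ : 0 < δ) (hδ' : δ ≤ 2 / 3) {k : ℕ} (hk : Real.log (2 * T.card) < k * δ ^ 2 / 8)
    (hk0 : 0 < k) :
    ∃ f : E →ₗ[ℝ] EuclideanSpace ℝ (Fin k), ∀ x ∈ T, |‖f x‖ ^ 2 - 1| ≤ δ := by
  -- `t = δ / 4` minimises the Chernoff exponent `k * (2t² - tδ)`, with value `-kδ² / 8`.
  obtain ⟨g, hg⟩ := exists_sum_exp_sum_inner_sq_le T hT (t := δ / 4)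
    (by rw [abs_of_pos (by positivity)]; linarith) k
  have hkR : (0 : ℝ) < k := by exact_mod_cast hk0
  refine ⟨(√k)⁻¹ • ((WithLp.linearEquiv 2 ℝ (Fin k → ℝ)).symm.toLinearMap ∘ₗ
    LinearMap.pi fun j => (innerₗ E (g j))), fun x hx => ?_⟩
  set S := ∑ j, inner ℝ x (g j) ^ 2 with hS
  have hnorm : ∀ y : EuclideanSpace ℝ (Fin k), (∀ j, y j = (√k)⁻¹ * inner ℝ (g j) x) →
      ‖y‖ ^ 2 = S / k := by
    intro y hy
    rw [EuclideanSpace.norm_sq_eq, hS, Finset.sum_div]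
    refine Finset.sum_congr rfl fun j _ => ?_
    rw [hy, Real.norm_eq_abs, sq_abs, mul_pow, inv_pow, Real.sq_sqrt hkR.le, real_inner_comm]
    field_simp
  rw [hnorm _ fun j => by simp]
  by_contra! hcon
  have hTpos : (0 : ℝ) < 2 * T.card := by
    have : 0 < T.card := Finset.card_pos.2 ⟨x, hx⟩
    positivity
  have hterm := (Finset.single_le_sum (f := fun x =>
    Real.exp (δ / 4 * ((∑ j, inner ℝ x (g j) ^ 2) - k)) +
        Real.exp (-(δ / 4) * ((∑ j, inner ℝ x (g j) ^ 2) - k)))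
    (fun x _ => by positivity) hx).trans hg
  simp only [← hS] at hterm
  have hexp : Real.exp (k * δ ^ 2 / 4) ≤ 2 * T.card * Real.exp (2 * (δ / 4) ^ 2 * k) := by
    refine le_trans ?_ hterm
    have hdiv : S / k - 1 = (S - k) / k := by field_simp
    rw [hdiv, abs_div, abs_of_pos hkR, lt_div_iff₀ hkR] at hcon
    rcases lt_abs.1 hcon with h | h
    · refine le_trans (Real.exp_le_exp.2 ?_) (le_add_of_nonneg_right (Real.exp_pos _).le)
      nlinarith
    · refine le_trans (Real.exp_le_exp.2 ?_) (le_add_of_nonneg_left (Real.exp_pos _).le)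
      nlinarith
  have hlog := Real.log_le_log (Real.exp_pos _) hexp
  rw [Real.log_exp, Real.log_mul hTpos.ne' (Real.exp_pos _).ne', Real.log_exp] at hlog
  nlinarith

/-- The **Johnson-Lindenstrauss lemma** for inner products of finitely many unit vectors. -/
lemma exists_linearMap_abs_inner_sub_inner_le [DecidableEq E] (T : Finset E)
    (hT : ∀ x ∈ T, ‖x‖ = 1) {δ : ℝ} (hδ : 0 < δ) (hδ' : δ ≤ 2 / 3) {k : ℕ}
    (hk : Real.log (2 * T.card) < k * δ ^ 2 / 16) (hk0 : 0 < k) :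
    ∃ f : E →ₗ[ℝ] EuclideanSpace ℝ (Fin k),
      ∀ x ∈ T, ∀ y ∈ T, |inner ℝ (f x) (f y) - inner ℝ x y| ≤ δ := by
  rcases T.eq_empty_or_nonempty with rfl | hne
  · exact ⟨0, by simp⟩
  have hTpos : (0 : ℝ) < T.card := by exact_mod_cast Finset.card_pos.2 hne
  -- Polarization: control of `‖x ± y‖²` gives control of inner products. Passing to at most `2|T|²`
  -- directions doubles the logarithm, hence 16 in place of 8.
  let D : Finset E := (T ×ˢ T).image (fun p => p.1 + p.2) ∪ (T ×ˢ T).image (fun p => p.1 - p.2)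
  let U : Finset E := (D.filter (· ≠ 0)).image fun x => ‖x‖⁻¹ • x
  have hU : ∀ x ∈ U, ‖x‖ = 1 := by
    intro x hx
    obtain ⟨y, hy, rfl⟩ := Finset.mem_image.1 hx
    exact norm_smul_inv_norm (𝕜 := ℝ) (Finset.mem_filter.1 hy).2
  have hcard : U.card ≤ 2 * T.card ^ 2 := by
    calc U.card ≤ D.card := Finset.card_image_le.trans (Finset.card_filter_le _ _)
      _ ≤ (T ×ˢ T).card + (T ×ˢ T).card := (Finset.card_union_le _ _).trans
        (add_le_add Finset.card_image_le Finset.card_image_le)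
      _ = _ := by rw [Finset.card_product]; ring
  have hlog : Real.log (2 * U.card) < k * δ ^ 2 / 8 := by
    rcases Nat.eq_zero_or_pos U.card with h0 | h0
    · rw [h0]; simp only [Nat.cast_zero, mul_zero, Real.log_zero]; positivity
    have h1 : (2 * U.card : ℝ) ≤ (2 * T.card) ^ 2 := by
      have : (U.card : ℝ) ≤ 2 * T.card ^ 2 := by exact_mod_cast hcard
      linarith
    have h2 := Real.log_le_log (by positivity) h1
    rw [Real.log_pow] at h2
    push_cast at h2
    linarith
  obtain ⟨f, hf⟩ := exists_linearMap_abs_norm_sq_sub_one_le U hU hδ hδ' hlog hk0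
  have hD : ∀ x ∈ D, |‖f x‖ ^ 2 - ‖x‖ ^ 2| ≤ δ * ‖x‖ ^ 2 := by
    intro x hx
    rcases eq_or_ne x 0 with rfl | h0
    · simp
    have h := hf _ (Finset.mem_image_of_mem _ (Finset.mem_filter.2 ⟨hx, h0⟩))
    have hpos : 0 < ‖x‖ := norm_pos_iff.2 h0
    rw [map_smul, norm_smul, norm_inv, norm_norm] at h
    have e : ‖f x‖ ^ 2 - ‖x‖ ^ 2 = ((‖x‖⁻¹ * ‖f x‖) ^ 2 - 1) * ‖x‖ ^ 2 := by
      field_simp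
    rw [e, abs_mul, abs_of_nonneg (sq_nonneg ‖x‖)]
    gcongr
  refine ⟨f, fun x hx y hy => ?_⟩
  have hp := hD (x + y) (Finset.mem_union_left _
    (Finset.mem_image.2 ⟨(x, y), Finset.mk_mem_product hx hy, rfl⟩))
  have hm := hD (x - y) (Finset.mem_union_right _
    (Finset.mem_image.2 ⟨(x, y), Finset.mk_mem_product hx hy, rfl⟩))
  rw [map_add, norm_add_sq_real, norm_add_sq_real, hT x hx, hT y hy] at hp
  rw [map_sub, norm_sub_sq_real, norm_sub_sq_real, hT x hx, hT y hy] at hm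
  rw [abs_le] at hp hm ⊢
  constructor <;> linarith [hp.1, hp.2, hm.1, hm.2]

/-! ### Cpsd matrices from squared inner products -/

lemma trace_sum_vecMulVec_mul_sum_vecMulVec {ι κ m : Type*} [Fintype m] (s : Finset ι)
    (t : Finset κ) (u : ι → m → ℝ) (v : κ → m → ℝ) :
    ((∑ b ∈ t, Matrix.vecMulVec (v b) (v b)) * ∑ a ∈ s, Matrix.vecMulVec (u a) (u a)).trace =
      ∑ a ∈ s, ∑ b ∈ t, (u a ⬝ᵥ v b) ^ 2 := by
  rw [Finset.sum_mul_sum]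
  simp_rw [Matrix.trace_sum]
  rw [Finset.sum_comm]
  refine Finset.sum_congr rfl fun a _ => Finset.sum_congr rfl fun b _ => ?_
  rw [Matrix.vecMulVec_mul_vecMulVec, Matrix.trace_vecMulVec, dotProduct_smul, smul_eq_mul,
    dotProduct_comm (v b), sq]

/-- Sums of squared inner products of families of vectors form a cpsd matrix, with cpsd-rank at
most the dimension of the space. -/
lemma isCpsd_and_cpsdRank_le_finrank {n : ℕ} {α : Type*} (s : Fin n → Finset α)
    (y : Fin n → α → E) (hE : 1 ≤ finrank ℝ E) {N : Matrix (Fin n) (Fin n) ℝ}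
    (hN : ∀ i j, N i j = ∑ a ∈ s i, ∑ b ∈ s j, inner ℝ (y i a) (y j b) ^ 2) :
    IsCpsd N ∧ cpsdRank N ≤ finrank ℝ E := by
  let B := stdOrthonormalBasis ℝ E
  have h : IsPsdGramRep N fun i =>
      ∑ a ∈ s i, Matrix.vecMulVec (B.repr (y i a)).ofLp (B.repr (y i a)).ofLp := by
    refine ⟨fun i => Matrix.posSemidef_sum _ fun a _ => ?_, fun i j => ?_⟩
    · simpa using Matrix.posSemidef_vecMulVec_self_star (B.repr (y i a)).ofLp
    · rw [hN, trace_sum_vecMulVec_mul_sum_vecMulVec]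
      refine Finset.sum_congr rfl fun a _ => Finset.sum_congr rfl fun b _ => ?_
      rw [← B.repr.inner_map_map, EuclideanSpace.inner_eq_star_dotProduct, dotProduct_comm]
      simp
  exact ⟨⟨_, hE, _, h⟩, Nat.sInf_le ⟨hE, _, h⟩⟩

/-- An orthogonal projection is the sum of the rank one projections onto an orthonormal family. -/
lemma IsStarProjection.exists_eq_sum_vecMulVec {d : ℕ} {P : Matrix (Fin d) (Fin d) ℝ}
    (hP : IsStarProjection P) :
    ∃ (s : Finset (Fin d)) (u : Fin d → EuclideanSpace ℝ (Fin d)), (∀ a, ‖u a‖ = 1) ∧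
      P = ∑ a ∈ s, Matrix.vecMulVec (u a).ofLp (u a).ofLp ∧ P.trace = s.card := by
  have hH : P.IsHermitian := hP.isSelfAdjoint
  have h01 : ∀ a, hH.eigenvalues a = 0 ∨ hH.eigenvalues a = 1 := fun a =>
    hP.isIdempotentElem.spectrum_subset ℝ (hH.eigenvalues_mem_spectrum_real a)
  let s := Finset.univ.filter fun a => hH.eigenvalues a = 1
  refine ⟨s, fun a => hH.eigenvectorBasis a, fun a => hH.eigenvectorBasis.norm_eq_one a, ?_, ?_⟩
  · conv_lhs => rw [hH.spectral_theorem, Unitary.conjStarAlgAut_apply]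
    ext x y
    rw [Finset.sum_filter, Matrix.sum_apply]
    rw [Matrix.mul_apply]
    simp only [Matrix.mul_diagonal, Matrix.star_eq_conjTranspose, Matrix.conjTranspose_apply]
    refine Finset.sum_congr rfl fun a _ => ?_
    rcases h01 a with h | h <;>
      simp [h, Matrix.vecMulVec_apply, Matrix.IsHermitian.eigenvectorUnitary_apply]
  · rw [hH.trace_eq_sum_eigenvalues, Finset.card_filter]
    push_cast
    exact Finset.sum_congr rfl fun a _ => by rcases h01 a with h | h <;> simp [h]

lemma card_univ_sigma_le {n : ℕ} {α : Type*} {s : Fin n → Finset α} {ℓ : ℕ}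
    (hs : ∀ i, (s i).card ≤ ℓ) : (Finset.univ.sigma s).card ≤ n * ℓ := by
  rw [Finset.card_sigma]
  simpa using Finset.sum_le_card_nsmul Finset.univ _ ℓ fun i _ => hs i

/-- A matrix of sums of squared inner products of `n` families of at most `ℓ` vectors has cpsd-rank
at most `n * ℓ`. -/
lemma cpsdRank_le_mul {V : Type*} [NormedAddCommGroup V] [InnerProductSpace ℝ V] {n ℓ : ℕ}
    {α : Type*} (s : Fin n → Finset α) (u : Fin n → α → V)
    (hs : ∀ i, (s i).card ≤ ℓ) {i₀ : Fin n} {a₀ : α} (h₀ : a₀ ∈ s i₀) (hu₀ : u i₀ a₀ ≠ 0)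
    {M : Matrix (Fin n) (Fin n) ℝ}
    (hM : ∀ i j, M i j = ∑ a ∈ s i, ∑ b ∈ s j, inner ℝ (u i a) (u j b) ^ 2) :
    cpsdRank M ≤ n * ℓ := by
  classical
  let F : Finset V := (Finset.univ.sigma s).image fun p => u p.1 p.2
  let W := Submodule.span ℝ (F : Set V)
  have hmem : ∀ i, ∀ a ∈ s i, u i a ∈ W := fun i a ha =>
    Submodule.subset_span (Finset.mem_coe.2 (Finset.mem_image.2 ⟨⟨i, a⟩, by simpa using ha, rfl⟩))
  let w : Fin n → α → W := fun i a => if h : u i a ∈ W then ⟨u i a, h⟩ else 0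
  have hw : ∀ i, ∀ a ∈ s i, (w i a : V) = u i a := fun i a ha => by simp [w, hmem i a ha]
  -- The cpsd-rank only admits dimensions `≥ 1`.
  have : Nontrivial W := ⟨⟨w i₀ a₀, 0, fun h => hu₀ (by rw [← hw i₀ a₀ h₀, h]; rfl)⟩⟩
  have h := (isCpsd_and_cpsdRank_le_finrank s w finrank_pos (N := M) fun i j => by
    rw [hM]
    refine Finset.sum_congr rfl fun a ha => Finset.sum_congr rfl fun b hb => ?_
    rw [Submodule.coe_inner, hw i a ha, hw j b hb]).2
  exact h.trans ((finrank_span_finset_le_card F).trans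
    (Finset.card_image_le.trans (card_univ_sigma_le hs)))

lemma abs_sum_sum_sq_sub_sum_sum_sq_le {α : Type*} {s t : Finset α} {x y : α → α → ℝ} {ℓ : ℕ}
    (hs : s.card ≤ ℓ) (ht : t.card ≤ ℓ) {δ : ℝ} (hδ : 0 ≤ δ)
    (hx : ∀ a ∈ s, ∀ b ∈ t, |x a b| ≤ 1) (hxy : ∀ a ∈ s, ∀ b ∈ t, |y a b - x a b| ≤ δ) :
    |∑ a ∈ s, ∑ b ∈ t, x a b ^ 2 - ∑ a ∈ s, ∑ b ∈ t, y a b ^ 2| ≤ ℓ ^ 2 * (δ * (2 + δ)) := by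
  have hst : (s.card : ℝ) * t.card ≤ ℓ ^ 2 := by
    have := Nat.mul_le_mul hs ht
    rw [sq]; exact_mod_cast this
  rw [← Finset.sum_sub_distrib]
  simp_rw [← Finset.sum_sub_distrib]
  calc |∑ a ∈ s, ∑ b ∈ t, (x a b ^ 2 - y a b ^ 2)|
      ≤ ∑ a ∈ s, ∑ b ∈ t, δ * (2 + δ) := by
        refine (Finset.abs_sum_le_sum_abs _ _).trans (Finset.sum_le_sum fun a ha =>
          (Finset.abs_sum_le_sum_abs _ _).trans (Finset.sum_le_sum fun b hb => ?_))
        have h1 := abs_le.1 (hx a ha b hb)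
        have h2 := hxy a ha b hb
        have h3 : |x a b + y a b| ≤ 2 + δ := by
          have h4 := abs_le.1 h2
          rw [abs_le]; constructor <;> linarith [h1.1, h1.2, h4.1, h4.2]
        rw [sq_sub_sq, abs_mul, mul_comm, abs_sub_comm]
        exact mul_le_mul h2 h3 (abs_nonneg _) hδ
    _ = s.card * t.card * (δ * (2 + δ)) := by simp [mul_assoc]
    _ ≤ _ := by gcongr

/-- Dimension reduction for matrices of sums of squared inner products of unit vectors. -/
lemma exists_isCpsd_cpsdRank_le_abs_sub_lt {n ℓ k : ℕ} {α : Type*} (s : Fin n → Finset α)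
    (u : Fin n → α → E) (hu : ∀ i a, ‖u i a‖ = 1) (hs : ∀ i, (s i).card ≤ ℓ) (hn : 0 < n)
    (hℓ : 0 < ℓ) {M : Matrix (Fin n) (Fin n) ℝ}
    (hM : ∀ i j, M i j = ∑ a ∈ s i, ∑ b ∈ s j, inner ℝ (u i a) (u j b) ^ 2)
    {ε : ℝ} (hε : 0 < ε) (hεℓ : ε ≤ ℓ) (hk0 : 0 < k)
    (hk : 144 * ℓ ^ 4 * Real.log (2 * (n * ℓ)) / ε ^ 2 < k) :
    ∃ N : Matrix (Fin n) (Fin n) ℝ, IsCpsd N ∧ cpsdRank N ≤ k ∧ ∀ i j, |M i j - N i j| < ε := by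
  classical
  have hℓ1 : (1 : ℝ) ≤ ℓ := by exact_mod_cast hℓ
  have hn1 : (1 : ℝ) ≤ n := by exact_mod_cast hn
  let T : Finset E := (Finset.univ.sigma s).image fun p => u p.1 p.2
  have hT : ∀ x ∈ T, ‖x‖ = 1 := by
    intro x hx
    obtain ⟨p, -, rfl⟩ := Finset.mem_image.1 hx
    exact hu _ _
  have hTc : (T.card : ℝ) ≤ n * ℓ := by
    exact_mod_cast Finset.card_image_le.trans (card_univ_sigma_le hs)
  -- The error `ℓ²δ(2 + δ) = (ε / 3)(2 + δ)` is below `ε` because `δ < 1`; and `16 / δ² = 144ℓ⁴ /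
  -- ε²`.
  set δ : ℝ := ε / (3 * ℓ ^ 2) with hδdef
  have hδ : 0 < δ := by positivity
  have hδε : ℓ ^ 2 * δ = ε / 3 := by rw [hδdef]; field_simp
  have hδ1 : δ ≤ 1 / 3 := by
    rw [hδdef, div_le_iff₀ (by positivity)]; nlinarith
  have hlog : Real.log (2 * T.card) < k * δ ^ 2 / 16 := by
    have h1 : Real.log (2 * T.card) ≤ Real.log (2 * (n * ℓ)) := by
      rcases Nat.eq_zero_or_pos T.card with h0 | h0
      · rw [h0]; simp only [Nat.cast_zero, mul_zero, Real.log_zero]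
        exact Real.log_nonneg (by nlinarith)
      · exact Real.log_le_log (by positivity) (by linarith)
    refine h1.trans_lt ?_
    rw [div_lt_iff₀ (by positivity)] at hk
    have h2 : k * δ ^ 2 / 16 = k * ε ^ 2 / (144 * ℓ ^ 4) := by
      rw [hδdef]; field_simp; norm_num
    rw [h2, lt_div_iff₀ (by positivity)]
    linarith
  obtain ⟨f, hf⟩ := exists_linearMap_abs_inner_sub_inner_le T hT hδ (by linarith) hlog hk0
  have hmem : ∀ i, ∀ a ∈ s i, u i a ∈ T := fun i a ha =>
    Finset.mem_image.2 ⟨⟨i, a⟩, by simpa using ha, rfl⟩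
  have hfin : finrank ℝ (EuclideanSpace ℝ (Fin k)) = k := finrank_euclideanSpace_fin
  obtain ⟨h1, h2⟩ := isCpsd_and_cpsdRank_le_finrank s (fun i a => f (u i a)) (by omega)
    (N := fun i j => ∑ a ∈ s i, ∑ b ∈ s j, inner ℝ (f (u i a)) (f (u j b)) ^ 2) fun _ _ => rfl
  refine ⟨_, h1, by rwa [hfin] at h2, fun i j => ?_⟩
  rw [hM]
  refine (abs_sum_sum_sq_sub_sum_sum_sq_le (hs i) (hs j) hδ.le (fun a _ b _ => ?_)
    fun a ha b hb => hf _ (hmem i a ha) _ (hmem j b hb)).trans_lt ?_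
  · simpa [hu] using abs_real_inner_le_norm (u i a) (u j b)
  · calc (ℓ : ℝ) ^ 2 * (δ * (2 + δ)) = ε / 3 * (2 + δ) := by rw [← hδε]; ring
      _ < ε := by nlinarith

lemma isCpsd_zero_and_cpsdRank_zero_le (n : ℕ) :
    IsCpsd (0 : Matrix (Fin n) (Fin n) ℝ) ∧ cpsdRank (0 : Matrix (Fin n) (Fin n) ℝ) ≤ 1 := by
  have h : IsPsdGramRep (0 : Matrix (Fin n) (Fin n) ℝ)
      fun _ => (0 : Matrix (Fin 1) (Fin 1) ℝ) := ⟨fun _ => .zero, by simp⟩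
  exact ⟨⟨1, le_rfl, _, h⟩, Nat.sInf_le ⟨le_rfl, _, h⟩⟩

end CpsdApproximation

/-! ### The approximation theorem -/

theorem corollary3p3 {n d : ℕ} (M : Matrix (Fin n) (Fin n) ℝ)
    (P : Fin n → Matrix (Fin d) (Fin d) ℝ)
    (hP : ∀ i, IsStarProjection (P i))
    (hM : IsPsdGramRep M P)
    (L : ℝ) (hL : IsGreatest (Set.range fun i => M i i) L) :
    IsGreatest (Set.range fun i => (P i).trace) L ∧
    ∀ ε : ℝ, 0 < ε → ε < 1 / 2 * L ^ 2 →
      ∃ N : Matrix (Fin n) (Fin n) ℝ, IsCpsd N ∧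
        (cpsdRank N : ℝ) ≤
          min ((n : ℝ) * (⌈9 * L ^ 3 / (2 * ε ^ 2)⌉ : ℝ))
            ((6 * L) ^ 4 * Real.log ((n : ℝ) * (⌈18 * L ^ 3 / ε ^ 2⌉ : ℝ) + 1) / ε ^ 2) ∧
        ∀ i j, |M i j - N i j| < ε := by
  have hdiag : (fun i => M i i) = fun i => (P i).trace := by
    funext i
    rw [hM.2, (hP i).isIdempotentElem.eq]
  refine ⟨hdiag ▸ hL, fun ε hε hεL => ?_⟩
  rw [hdiag] at hL
  choose s u hu hPu htr using fun i => (hP i).exists_eq_sum_vecMulVec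
  obtain ⟨⟨i₀, hi₀⟩, hub⟩ := hL
  have hMu : ∀ i j, M i j = ∑ a ∈ s i, ∑ b ∈ s j, inner ℝ (u i a) (u j b) ^ 2 := by
    intro i j
    rw [hM.2, hPu i, hPu j, trace_sum_vecMulVec_mul_sum_vecMulVec]
    refine Finset.sum_congr rfl fun a _ => Finset.sum_congr rfl fun b _ => ?_
    rw [EuclideanSpace.inner_eq_star_dotProduct, dotProduct_comm]
    simp
  obtain ⟨ℓ, hℓ⟩ : ∃ ℓ : ℕ, (s i₀).card = ℓ := ⟨_, rfl⟩
  have hLℓ : L = ℓ := by rw [← hℓ, ← htr]; exact hi₀.symm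
  subst hLℓ
  have hs : ∀ i, (s i).card ≤ ℓ := fun i => by
    have := hub ⟨i, rfl⟩
    simp only [htr] at this
    exact_mod_cast this
  have hℓ0 : 0 < ℓ := by
    rcases Nat.eq_zero_or_pos ℓ with rfl | h
    · norm_num at hεL; linarith
    · exact h
  have hn : 0 < n := i₀.pos
  have hℓ1 : (1 : ℝ) ≤ ℓ := by exact_mod_cast hℓ0
  have hn1 : (1 : ℝ) ≤ n := by exact_mod_cast hn
  have hceil : (1 : ℝ) ≤ ⌈18 * (ℓ : ℝ) ^ 3 / ε ^ 2⌉ := by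
    exact_mod_cast Int.one_le_ceil_iff.2 (by positivity)
  have hceil' : (1 : ℝ) ≤ ⌈9 * (ℓ : ℝ) ^ 3 / (2 * ε ^ 2)⌉ := by
    exact_mod_cast Int.one_le_ceil_iff.2 (by positivity)
  set C : ℝ := (⌈18 * (ℓ : ℝ) ^ 3 / ε ^ 2⌉ : ℝ)
  have hlog2 : 1 / 2 ≤ Real.log (n * C + 1) :=
    (by linarith [Real.log_two_gt_d9] : (1 / 2 : ℝ) ≤ Real.log 2).trans
      (Real.log_le_log two_pos (by nlinarith))
  rcases lt_or_ge (ℓ : ℝ) ε with hlt | hle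
  · obtain ⟨h1, h2⟩ := isCpsd_zero_and_cpsdRank_zero_le n
    refine ⟨0, h1, (by exact_mod_cast h2 : (cpsdRank 0 : ℝ) ≤ 1).trans (le_min ?_ ?_), ?_⟩
    · nlinarith
    · rw [le_div_iff₀ (by positivity)]
      have h3 : ε ^ 2 ≤ (1 / 2 * (ℓ : ℝ) ^ 2) ^ 2 := by gcongr
      have h4 : (0 : ℝ) ≤ (ℓ : ℝ) ^ 4 := by positivity
      nlinarith
    · intro i j
      -- `tr (P i - P j)² ≥ 0` gives `2 * M i j ≤ tr (P i) + tr (P j) ≤ 2ℓ < 2ε`.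
      have h3 := (Matrix.posSemidef_conjTranspose_mul_self (P i - P j)).trace_nonneg
      have h4 : (P i - P j).conjTranspose = P i - P j :=
        ((hP i).isSelfAdjoint.sub (hP j).isSelfAdjoint :)
      rw [h4, mul_sub, sub_mul, sub_mul, (hP i).isIdempotentElem.eq,
        (hP j).isIdempotentElem.eq] at h3
      simp only [Matrix.trace_sub] at h3
      rw [← hM.2, Matrix.trace_mul_comm, ← hM.2] at h3
      have h5 := hub ⟨i, rfl⟩
      have h6 := hub ⟨j, rfl⟩
      have h7 : 0 ≤ M i j := by rw [hMu]; positivity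
      simp only at h5 h6
      rw [Matrix.zero_apply, sub_zero, abs_of_nonneg h7]
      linarith
  · have hε2 : ε ^ 2 ≤ (ℓ : ℝ) ^ 2 := by gcongr
    have hd : 1 ≤ d := by
      have := (Finset.card_le_univ (s i₀)).trans_eq (Fintype.card_fin d)
      omega
    by_cases hcmp : (n : ℝ) * ⌈9 * (ℓ : ℝ) ^ 3 / (2 * ε ^ 2)⌉ ≤
        (6 * ℓ) ^ 4 * Real.log (n * C + 1) / ε ^ 2
    · refine ⟨M, ⟨d, hd, P, hM⟩, ?_, fun i j => by simpa using hε⟩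
      rw [min_eq_left hcmp]
      obtain ⟨a₀, ha₀⟩ := Finset.card_pos.1 (hℓ ▸ hℓ0)
      have h1 : (cpsdRank M : ℝ) ≤ n * ℓ := by
        exact_mod_cast cpsdRank_le_mul s u hs ha₀ (norm_ne_zero_iff.1 (by simp [hu])) hMu
      refine h1.trans (mul_le_mul_of_nonneg_left (le_trans ?_ (Int.le_ceil _)) (by positivity))
      rw [le_div_iff₀ (by positivity)]
      nlinarith
    · rw [min_eq_right (not_le.1 hcmp).le]
      set B : ℝ := (6 * ℓ) ^ 4 * Real.log (n * C + 1) / ε ^ 2 with hB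
      have hB2 : 2 ≤ B := by
        rw [hB, le_div_iff₀ (by positivity)]
        have h4 : (ℓ : ℝ) ^ 2 ≤ (ℓ : ℝ) ^ 4 := pow_le_pow_right₀ hℓ1 (by norm_num)
        nlinarith
      have hCℓ : 2 * (ℓ : ℝ) ≤ C := by
        refine le_trans ?_ (Int.le_ceil _)
        rw [le_div_iff₀ (by positivity)]
        nlinarith
      have hlog : Real.log (2 * (n * ℓ)) ≤ Real.log (n * C + 1) :=
        Real.log_le_log (by positivity) (by nlinarith)
      -- As `6⁴ = 9 * 144`, only `B / 9` dimensions are needed, which leaves room for rounding `B`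
      -- down.
      have hk : 144 * (ℓ : ℝ) ^ 4 * Real.log (2 * (n * ℓ)) / ε ^ 2 < ⌊B⌋₊ := by
        calc _ ≤ 144 * (ℓ : ℝ) ^ 4 * Real.log (n * C + 1) / ε ^ 2 := by gcongr
          _ = B / 9 := by rw [hB]; ring
          _ < B - 1 := by linarith
          _ < _ := Nat.sub_one_lt_floor B
      obtain ⟨N, h1, h2, h3⟩ := exists_isCpsd_cpsdRank_le_abs_sub_lt s u hu hs hn hℓ0 hMu hε hle
        (Nat.floor_pos.2 (by linarith)) hk
      exact ⟨N, h1, le_trans (by exact_mod_cast h2) (Nat.floor_le (by linarith)), h3⟩
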